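/- All graphs are finite, simple and undirected. An induced matching in a graph $G$ is a set $M$ of pairwise disjoint edges of $G$ such that no endpoint of an edge in $M$ is adjacent in $G$ to an endpoint of a different edge in $M$. A tree decomposition of $G$ is a pair $(T,\beta)$ of a tree $T$ and a map $\beta\colon V(T)\to 2^{V(G)}$ such that both endpoints of every edge of $G$ lie in some common bag $\beta(x)$ and, for every $v\in V(G)$, the nodes $x$ with $v\in\beta(x)$ induce a nonempty subtree of $T$. The tree-independence number of $G$ is the minimum, over all tree decompositions $(T,\beta)$ of $G$, of $\max_{x\in V(T)}\alpha(G[\beta(x)])$, where $\alpha$ denotes the maximum size of an independent set. The induced matching treewidth of $G$ is the minimum, over all tree decompositions $(T,\beta)$ of $G$, of the maximum number of edges of an induced matching $M$ in $G$ for which some bag $\beta(x)$ contains at least one endpoint of every edge of $M$. Theorem. For every positive integer $t$ there is a constant $C_t$, depending only on $t$, such that for every positive integer $\mu$, every graph $G$ that has no induced subgraph isomorphic to the complete bipartite graph $K_{t,t}$ and whose induced matching treewidth is at most $\mu$ has tree-independence number at most $C_t\,\mu^{3t^2+1}$. -/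

import Mathlib

namespace SimpleGraph

universe u

/-- A tree decomposition of a graph `G`: a finite tree together with a bag of vertices of `G` for
each node, such that every edge of `G` has both endpoints in a common bag and, for each vertex `v`,
the nodes whose bags contain `v` induce a nonempty subtree. (An induced subgraph of a tree is a
tree exactly when it is connected, and `SimpleGraph.Connected` includes nonemptiness. As the tree
is finite, letting the nodes range over `Type` is no restriction.) -/
structure TreeDecomposition {V : Type u} (G : SimpleGraph V) where
  /-- The nodes of the tree. -/
  Node : Type
  finite_node : Finite Node
  /-- The tree. -/
  tree : SimpleGraph Node
  isTree : tree.IsTree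
  /-- The bags. -/
  bag : Node → Set V
  exists_bag_of_adj : ∀ u v : V, G.Adj u v → ∃ x : Node, u ∈ bag x ∧ v ∈ bag x
  connected_induce : ∀ v : V, (tree.induce {x : Node | v ∈ bag x}).Connected

/-- A finite set of pairwise disjoint edges of `G`. -/
def IsMatchingIn {V : Type u} (G : SimpleGraph V) (M : Finset (Sym2 V)) : Prop :=
  (∀ e ∈ M, e ∈ G.edgeSet) ∧
    ∀ e ∈ M, ∀ f ∈ M, e ≠ f → ∀ v : V, v ∈ e → v ∉ f

/-- A matching such that no two endpoints of distinct edges are adjacent. -/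
def IsInducedMatchingIn {V : Type u} (G : SimpleGraph V) (M : Finset (Sym2 V)) : Prop :=
  G.IsMatchingIn M ∧
    ∀ e ∈ M, ∀ f ∈ M, e ≠ f → ∀ u ∈ e, ∀ v ∈ f, ¬ G.Adj u v

/-- `μ(G, X)`: the maximum size of an induced matching in `G` each edge of which meets `X`. -/
noncomputable def inducedMatchingNumOn {V : Type u} (G : SimpleGraph V) (X : Set V) : ℕ :=
  sSup {k : ℕ | ∃ M : Finset (Sym2 V),
    G.IsInducedMatchingIn M ∧ (∀ e ∈ M, ∃ v ∈ e, v ∈ X) ∧ M.card = k}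

namespace TreeDecomposition

/-- The independence number of a tree decomposition: the maximum of `α(G[bag x])` over all
nodes `x`. -/
noncomputable def indepNum {V : Type u} {G : SimpleGraph V} (T : G.TreeDecomposition) : ℕ :=
  ⨆ x : T.Node, (G.induce (T.bag x)).indepNum

/-- The induced matching number of a tree decomposition: the maximum of `μ(G, bag x)` over all
nodes `x`. -/
noncomputable def inducedMatchingNum {V : Type u} {G : SimpleGraph V}
    (T : G.TreeDecomposition) : ℕ :=
  ⨆ x : T.Node, G.inducedMatchingNumOn (T.bag x)

/-- Every graph has a tree decomposition, with a single bag, so that the minima below are attained. -/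
instance {V : Type u} (G : SimpleGraph V) : Nonempty G.TreeDecomposition :=
  ⟨{ Node := Unit
     finite_node := inferInstance
     tree := ⊥
     isTree := IsTree.of_subsingleton
     bag := fun _ => Set.univ
     exists_bag_of_adj := fun _ _ _ => ⟨(), trivial, trivial⟩
     connected_induce := fun _ =>
       { preconnected := fun a b => by rw [Subsingleton.elim a b]
         nonempty := ⟨⟨(), trivial⟩⟩ } }⟩

end TreeDecomposition

/-- The tree-independence number: the minimum independence number of a tree decomposition. -/
noncomputable def treeIndepNum {V : Type u} (G : SimpleGraph V) : ℕ :=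
  ⨅ T : G.TreeDecomposition, T.indepNum

/-- The induced matching treewidth: the minimum induced matching number of a tree
decomposition. -/
noncomputable def inducedMatchingTreewidth {V : Type u} (G : SimpleGraph V) : ℕ :=
  ⨅ T : G.TreeDecomposition, T.inducedMatchingNum

end SimpleGraph

/-!
Fix `k = μ` and a tree decomposition `T` whose bags have induced matching number at most `k`. The
proof replaces each bag `X` by a separator `S` of small independence number, and then builds a new
tree decomposition from these separators.

*Separators.* Count degrees by independent sets: a vertex is high for `X` if it has `D` independent
neighbours along edges that meet `X`. If there were many independent high vertices, then, since the
Kővári–Sós–Turán theorem makes the bipartite graphs between independent sets sparse, each of `k + 1`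
of them could be given a private neighbour, and these edges would form an induced matching that
meets `X` (`InducedMatchingNumOnLE.indepNumOnLE_of_high`). So the set `Q` of high vertices has small
independence number. Take a maximum induced matching `M` that avoids `Q` and whose edges meet `X`.
The part `R` of `X` in its closed neighbourhood has small independence number because the vertices
of `M` are not high. The rest `Y` of `X` is independent by maximality, and
`U = N(Y) \ Q` has small independence number, as otherwise another induced matching of size `k + 1`
appears between `Y` and `U`. Hence `S = Q ∪ R ∪ U` has small independence number, and the vertices
of `X \ S` are isolated in `G - S` (`InducedMatchingNumOnLE.exists_separator`).

*Balance.* For every independent set `J` with at least two vertices, some `S` leaves no component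
with more than half of `J`. Otherwise, the components violating this pairwise intersect, while
each of them avoids its bag; the Helly property of subtrees excludes this
(`TreeDecomposition.exists_balanced`).

*Recursion.* Balanced separators of independence number `σ` give a tree decomposition of independence
number at most `5σ`, by the recursion of Robertson and Seymour (`IsBagTree.exists_extend`): a set `W`
with `α(W) = 4σ`, to be kept in one bag, is split by a separator that is balanced for a maximum
independent set of `W`. With `D` of order `k ^ (t + 1)`, `σ` is of order `k ^ (t + 2)`, and
`t + 2 ≤ 3 * t ^ 2 + 1`.
-/

namespace SimpleGraph

universe u

/-! ### Partial tree decompositions -/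

/-- A partial tree decomposition covering the vertex set `Z`, remembered only through its set of
bags `𝓑`: there is a finite tree with bags inside `Z`, whose set of bags is `𝓑`, in which the nodes
containing a given vertex of `Z` induce a nonempty subtree. No graph on `V` is involved; edges are
tracked separately. -/
def IsBagTree {V : Type u} (Z : Set V) (𝓑 : Set (Set V)) : Prop :=
  ∃ (N : Type) (_ : Finite N) (T : SimpleGraph N) (bag : N → Set V),
    T.IsTree ∧ Set.range bag = 𝓑 ∧ (∀ x, bag x ⊆ Z) ∧
      ∀ v ∈ Z, (T.induce {x | v ∈ bag x}).Connected

theorem IsBagTree.subset {V : Type u} {Z : Set V} {𝓑 : Set (Set V)} (h : IsBagTree Z 𝓑)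
    {B : Set V} (hB : B ∈ 𝓑) : B ⊆ Z := by
  obtain ⟨N, _, T, bag, -, rfl, hsub, -⟩ := h
  obtain ⟨x, rfl⟩ := hB
  exact hsub x

theorem isBagTree_empty {V : Type u} : IsBagTree (∅ : Set V) {∅} :=
  ⟨Unit, inferInstance, ⊥, fun _ => ∅, IsTree.of_subsingleton, by simp, by simp, by simp⟩

/-- Attaching a new leaf `none` to the node `x` of a tree gives a tree. -/
theorem IsTree.map_some_sup_edge {N : Type*} [Finite N] {T : SimpleGraph N} (hT : T.IsTree)
    (x : N) : (T.map (Function.Embedding.some : N ↪ Option N) ⊔ edge none (some x)).IsTree := by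
  classical
  rw [isTree_iff_connected_and_card]
  have hle : T.map (Function.Embedding.some : N ↪ Option N) ≤
      T.map (Function.Embedding.some : N ↪ Option N) ⊔ edge none (some x) := le_sup_left
  have hedge : (T.map (Function.Embedding.some : N ↪ Option N) ⊔ edge none (some x)).Adj
      none (some x) := Or.inr (by simp [edge_adj])
  have hr : ∀ a : Option N,
      (T.map (Function.Embedding.some : N ↪ Option N) ⊔ edge none (some x)).Reachable
        a (some x) := by
    rintro (_ | a)
    · exact hedge.reachable
    · exact ((hT.connected.preconnected a x).map
        (Embedding.map Function.Embedding.some T).toHom).mono hle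
  refine ⟨⟨fun a b => (hr a).trans (hr b).symm⟩, ?_⟩
  have hE : (T.map (Function.Embedding.some : N ↪ Option N) ⊔ edge none (some x)).edgeSet =
      insert s(none, some x) (Sym2.map some '' T.edgeSet) := by
    rw [edgeSet_sup, edgeSet_edge_of_ne (by simp), edgeSet_map, Set.union_comm]
    rfl
  have hc := (isTree_iff_connected_and_card.1 hT).2
  rw [hE, Nat.card_coe_set_eq, Set.ncard_insert_of_notMem, Set.ncard_image_of_injective _
    (Sym2.map.injective (Option.some_injective N)), Finite.card_option, ← hc, Nat.card_coe_set_eq]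
  rintro ⟨e, -, he⟩
  induction e with
  | _ a b => simp at he

/-- A new bag `B` can be attached as a leaf next to an old bag `B₀` as soon as `B₀` contains all
the old vertices of `B`. -/
theorem IsBagTree.addLeaf {V : Type u} {Z : Set V} {𝓑 : Set (Set V)} (h : IsBagTree Z 𝓑)
    {B₀ B : Set V} (hB₀ : B₀ ∈ 𝓑) (hB : B ∩ Z ⊆ B₀) : IsBagTree (Z ∪ B) (insert B 𝓑) := by
  obtain ⟨N, _, T, bag, hT, rfl, hsub, hconn⟩ := h
  obtain ⟨x, rfl⟩ := hB₀
  set T' := T.map (Function.Embedding.some : N ↪ Option N) ⊔ edge none (some x) with hT'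
  have hle : T.map (Function.Embedding.some : N ↪ Option N) ≤ T' := le_sup_left
  have hedge : T'.Adj none (some x) := Or.inr (by simp [edge_adj])
  have hold : ∀ v ∈ Z, (T'.induce (some '' {y | v ∈ bag y})).Preconnected := by
    intro v hv
    let f : T.induce {y | v ∈ bag y} →g T'.induce (some '' {y | v ∈ bag y}) :=
      { toFun := fun y => ⟨some y.1, y.1, y.2, rfl⟩
        map_rel' := fun {a b} hab => hle ((map_adj_apply (f := Function.Embedding.some)).2 hab) }
    rintro ⟨_, a, ha, rfl⟩ ⟨_, b, hb, rfl⟩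
    exact ((hconn v hv).preconnected ⟨a, ha⟩ ⟨b, hb⟩).map f
  have hnone : (T'.induce {(none : Option N)}).Preconnected := by
    rintro ⟨_, rfl⟩ ⟨_, rfl⟩
    rfl
  refine ⟨Option N, inferInstance, T', fun o => o.elim B bag, hT.map_some_sup_edge x, ?_, ?_, ?_⟩
  · ext S
    simp [Set.mem_range, Option.exists, eq_comm]
  · rintro (_ | y)
    · exact Set.subset_union_right
    · exact (hsub y).trans Set.subset_union_left
  · intro v hv
    by_cases hvB : v ∈ B
    · by_cases hvZ : v ∈ Z
      · have hs : {o : Option N | v ∈ o.elim B bag} = {none} ∪ some '' {y | v ∈ bag y} := by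
          ext (_ | y) <;> simp [hvB]
        rw [hs]
        exact connected_induce_union hnone (hold v hvZ) rfl
          ⟨x, hB ⟨hvB, hvZ⟩, rfl⟩ hedge
      · have hs : {o : Option N | v ∈ o.elim B bag} = {none} := by
          ext (_ | y)
          · simp [hvB]
          · simpa using fun h => hvZ (hsub y h)
        rw [hs]
        exact { preconnected := hnone, nonempty := ⟨⟨none, rfl⟩⟩ }
    · have hvZ : v ∈ Z := hv.resolve_right hvB
      have hs : {o : Option N | v ∈ o.elim B bag} = some '' {y | v ∈ bag y} := by
        ext (_ | y) <;> simp [hvB]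
      rw [hs]
      obtain ⟨y, hy⟩ := (hconn v hvZ).nonempty
      exact { preconnected := hold v hvZ, nonempty := ⟨⟨some y, y, hy, rfl⟩⟩ }

/-! ### From balanced separators to a tree decomposition -/

variable {V : Type u} {G : SimpleGraph V}

/-- Every independent set of `G` contained in `S` has at most `n` vertices, that is,
`α(G[S]) ≤ n`. -/
def IndepNumOnLE (G : SimpleGraph V) (S : Set V) (n : ℕ) : Prop :=
  ∀ I : Finset V, (I : Set V) ⊆ S → G.IsIndepSet I → I.card ≤ n

theorem IndepNumOnLE.mono {S S' : Set V} {n n' : ℕ} (h : G.IndepNumOnLE S n) (hS : S' ⊆ S)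
    (hn : n ≤ n') : G.IndepNumOnLE S' n' :=
  fun I hI hI' => (h I (hI.trans hS) hI').trans hn

theorem IndepNumOnLE.union {S S' : Set V} {n n' : ℕ} (h : G.IndepNumOnLE S n)
    (h' : G.IndepNumOnLE S' n') : G.IndepNumOnLE (S ∪ S') (n + n') := by
  classical
  intro I hI hI'
  rw [← Finset.card_filter_add_card_filter_not (s := I) (· ∈ S)]
  refine add_le_add (h _ ?_ (hI'.mono (Finset.coe_subset.2 (Finset.filter_subset _ _))))
    (h' _ ?_ (hI'.mono (Finset.coe_subset.2 (Finset.filter_subset _ _))))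
  · intro v hv
    exact (Finset.mem_filter.1 hv).2
  · intro v hv
    have := Finset.mem_filter.1 hv
    exact (hI this.1).resolve_left this.2

/-- The vertices reachable from `v` in `G - S`. For `v ∉ S` this is the component of `v` in
`G - S`; for `v ∈ S` it is `{v}`. -/
def componentAvoiding (G : SimpleGraph V) (S : Set V) (v : V) : Set V :=
  {u | Relation.ReflTransGen (fun a b => G.Adj a b ∧ a ∉ S ∧ b ∉ S) v u}

theorem mem_componentAvoiding_self (S : Set V) (v : V) : v ∈ G.componentAvoiding S v :=
  Relation.ReflTransGen.refl

theorem componentAvoiding_eq {S : Set V} {v u : V} (h : u ∈ G.componentAvoiding S v) :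
    G.componentAvoiding S u = G.componentAvoiding S v := by
  have hsymm : ∀ {a b}, Relation.ReflTransGen (fun a b => G.Adj a b ∧ a ∉ S ∧ b ∉ S) a b →
      Relation.ReflTransGen (fun a b => G.Adj a b ∧ a ∉ S ∧ b ∉ S) b a := by
    intro a b h
    induction h with
    | refl => exact .refl
    | tail _ h ih => exact ih.head ⟨h.1.symm, h.2.2, h.2.1⟩
  ext w
  exact ⟨fun hw => Relation.ReflTransGen.trans h hw,
    fun hw => Relation.ReflTransGen.trans (hsymm h) hw⟩

theorem notMem_of_mem_componentAvoiding {S : Set V} {v u : V} (hv : v ∉ S)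
    (h : u ∈ G.componentAvoiding S v) : u ∉ S := by
  induction h with
  | refl => exact hv
  | tail _ h _ => exact h.2.2

/-- Pairwise disjoint pieces `C ∩ A`, `C ∈ 𝒟`, can be attached one after the other to the bag `B₁`,
if each of them, together with `S`, can be attached on its own to any partial decomposition that
meets it only in `B₁`. -/
theorem IsBagTree.exists_extend_iUnion {A S B₁ Z : Set V} {𝓑 : Set (Set V)} {P : Set V → Prop}
    (hZ : IsBagTree Z 𝓑) (hB₁ : B₁ ∈ 𝓑) (hP : ∀ B ∈ 𝓑, P B) (𝒟 : Finset (Set V))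
    (hdisj : (𝒟 : Set (Set V)).PairwiseDisjoint id)
    (hZA : ∀ C ∈ 𝒟, Z ∩ (C ∩ A ∪ S) ⊆ B₁)
    (hSZ : S ⊆ Z)
    (hext : ∀ C ∈ 𝒟, ∀ (Z' : Set V) (𝓑' : Set (Set V)), IsBagTree Z' 𝓑' → B₁ ∈ 𝓑' →
      (∀ B ∈ 𝓑', P B) → Z' ∩ (C ∩ A ∪ S) ⊆ B₁ →
      ∃ 𝓑'' ⊇ 𝓑', IsBagTree (Z' ∪ (C ∩ A ∪ S)) 𝓑'' ∧ (∀ B ∈ 𝓑'', P B) ∧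
        ∀ u ∈ C ∩ A ∪ S, ∀ v ∈ C ∩ A ∪ S, G.Adj u v → ∃ B ∈ 𝓑'', u ∈ B ∧ v ∈ B) :
    ∃ 𝓑' ⊇ 𝓑, IsBagTree (Z ∪ ⋃ C ∈ 𝒟, (C ∩ A)) 𝓑' ∧ (∀ B ∈ 𝓑', P B) ∧
      ∀ C ∈ 𝒟, ∀ u ∈ C ∩ A ∪ S, ∀ v ∈ C ∩ A ∪ S, G.Adj u v → ∃ B ∈ 𝓑', u ∈ B ∧ v ∈ B := by
  classical
  induction 𝒟 using Finset.induction_on with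
  | empty => exact ⟨𝓑, subset_rfl, by simpa using hZ, hP, by simp⟩
  | insert C 𝒟 hC ih =>
    obtain ⟨𝓑', hsub, htree, hP', hedge⟩ := ih
      (hdisj.subset (Finset.coe_subset.2 (Finset.subset_insert _ _)))
      (fun C' hC' => hZA C' (Finset.mem_insert_of_mem hC'))
      (fun C' hC' => hext C' (Finset.mem_insert_of_mem hC'))
    obtain ⟨𝓑'', hsub', htree', hP'', hedge'⟩ := hext C (Finset.mem_insert_self _ _) _ 𝓑' htree
      (hsub hB₁) hP' (by
        rintro v ⟨hv, hv'⟩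
        rcases hv with hv | hv
        · exact hZA C (Finset.mem_insert_self _ _) ⟨hv, hv'⟩
        · rcases hv' with hv' | hv'
          · obtain ⟨C', hC', hvC'⟩ := Set.mem_iUnion₂.1 hv
            have hne : C ≠ C' := fun h => hC (h ▸ hC')
            exact (Set.disjoint_left.1 (hdisj (Finset.mem_coe.2 (Finset.mem_insert_self _ _))
              (Finset.mem_coe.2 (Finset.mem_insert_of_mem hC')) hne) hv'.1 hvC'.1).elim
          · exact hZA C (Finset.mem_insert_self _ _) ⟨hSZ hv', Or.inr hv'⟩)
    refine ⟨𝓑'', hsub.trans hsub', ?_, hP'', ?_⟩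
    · convert htree' using 1
      rw [Finset.set_biUnion_insert]
      ext v
      have := @hSZ v
      simp only [Set.mem_union]
      tauto
    · intro C' hC' u hu v hv huv
      rcases Finset.mem_insert.1 hC' with rfl | hC'
      · exact hedge' u hu v hv huv
      · obtain ⟨B, hB, h⟩ := hedge C' hC' u hu v hv huv
        exact ⟨B, hsub' hB, h⟩

/-- If `J` is a maximum independent set of `W` and `C` is a component of `G - S` with `α(G[S]) ≤ σ`,
then `α(G[W ∩ C]) ≤ σ + |J ∩ C|`: an independent subset of `W ∩ C` stays independent together with
`J \ (S ∪ C)`. -/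
theorem card_le_add_card_filter_componentAvoiding [DecidableEq V] {S W : Set V} {σ w : ℕ}
    (hS : G.IndepNumOnLE S σ) (hW : G.IndepNumOnLE W w) {J : Finset V} (hJW : (J : Set V) ⊆ W)
    (hJ : G.IsIndepSet J) (hJw : J.card = w) {v : V} (hv : v ∉ S) [DecidablePred (· ∈ S)]
    [DecidablePred (· ∈ G.componentAvoiding S v)] {I : Finset V}
    (hI : (I : Set V) ⊆ W ∩ G.componentAvoiding S v) (hIi : G.IsIndepSet I) :
    I.card ≤ σ + (J.filter (· ∈ G.componentAvoiding S v)).card := by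
  have h1 : (J.filter (· ∈ S)).card ≤ σ :=
    hS _ (fun u hu => (Finset.mem_filter.1 hu).2)
      (hJ.mono (Finset.coe_subset.2 (Finset.filter_subset _ _)))
  set K := J.filter (fun u => u ∉ S ∧ u ∉ G.componentAvoiding S v) with hK
  have h2 : J.card ≤ (J.filter (· ∈ S)).card +
      (J.filter (· ∈ G.componentAvoiding S v)).card + K.card := by
    calc J.card ≤ ((J.filter (· ∈ S) ∪ J.filter (· ∈ G.componentAvoiding S v)) ∪ K).card := by
          apply Finset.card_le_card
          intro u hu
          simp only [hK, Finset.mem_union, Finset.mem_filter]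
          tauto
      _ ≤ _ := (Finset.card_union_le _ _).trans (Nat.add_le_add_right (Finset.card_union_le _ _) _)
  have h3 : (I ∪ K).card ≤ w := by
    refine hW _ ?_ ?_
    · intro u hu
      rcases Finset.mem_union.1 (Finset.mem_coe.1 hu) with hu | hu
      · exact (hI hu).1
      · exact hJW (Finset.mem_filter.1 hu).1
    · have hcross : ∀ a ∈ I, ∀ b ∈ K, ¬ G.Adj a b := fun a ha b hb hab =>
        (Finset.mem_filter.1 hb).2.2 (Relation.ReflTransGen.tail (hI ha).2
          ⟨hab, notMem_of_mem_componentAvoiding hv (hI ha).2, (Finset.mem_filter.1 hb).2.1⟩)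
      intro a ha b hb hne
      rcases Finset.mem_union.1 (Finset.mem_coe.1 ha) with ha | ha <;>
        rcases Finset.mem_union.1 (Finset.mem_coe.1 hb) with hb | hb
      · exact hIi ha hb hne
      · exact hcross a ha b hb
      · exact fun h => hcross b hb a ha h.symm
      · exact hJ (Finset.mem_filter.1 ha).1 (Finset.mem_filter.1 hb).1 hne
  rw [Finset.card_union_of_disjoint] at h3
  · omega
  · rw [Finset.disjoint_left]
    intro u hu hu'
    exact (Finset.mem_filter.1 hu').2.2 (hI hu).2

/-- The recursion of Robertson and Seymour. Given balanced separators of independence number at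
most `σ`, a partial decomposition with a bag `B₀ ⊇ W` can be extended over a set `A` that it meets
only in `W`, keeping the bags of independence number at most `5σ`, as long as `α(G[W]) ≤ 4σ`. -/
theorem IsBagTree.exists_extend [Finite V] {σ : ℕ} (hσ : 0 < σ)
    (hsep : ∀ J : Finset V, 2 ≤ J.card → G.IsIndepSet J → ∃ S : Set V, G.IndepNumOnLE S σ ∧
      ∀ v ∉ S, 2 * ((J : Set V) ∩ G.componentAvoiding S v).ncard ≤ J.card)
    (A W Z : Set V) (𝓑 : Set (Set V)) (B₀ : Set V) (hZ : IsBagTree Z 𝓑) (hB₀ : B₀ ∈ 𝓑)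
    (hP : ∀ B ∈ 𝓑, G.IndepNumOnLE B (5 * σ)) (hWA : W ⊆ A) (hWB : W ⊆ B₀) (hZA : Z ∩ A ⊆ W)
    (hW : G.IndepNumOnLE W (4 * σ)) :
    ∃ 𝓑' ⊇ 𝓑, IsBagTree (Z ∪ A) 𝓑' ∧ (∀ B ∈ 𝓑', G.IndepNumOnLE B (5 * σ)) ∧
      ∀ u ∈ A, ∀ v ∈ A, G.Adj u v → ∃ B ∈ 𝓑', u ∈ B ∧ v ∈ B := by
  classical
  induction hm : A.ncard + (A \ W).ncard using Nat.strong_induction_on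
    generalizing A W Z 𝓑 B₀ with
  | _ m ih =>
  subst hm
  have hWZ : W ⊆ Z := hWB.trans (hZ.subset hB₀)
  by_cases hAW : A ⊆ W
  · obtain rfl := hAW.antisymm hWA
    refine ⟨𝓑, subset_rfl, ?_, hP, fun u hu v hv _ => ⟨B₀, hB₀, hWB hu, hWB hv⟩⟩
    rwa [Set.union_eq_left.2 hWZ]
  obtain ⟨a, haA, haW⟩ := Set.not_subset.1 hAW
  by_cases hsmall : G.IndepNumOnLE W (4 * σ - 1)
  · -- There is room in the bag: add one more vertex of `A` to it.
    have ha1 : G.IndepNumOnLE {a} 1 := by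
      intro I hI _
      exact Finset.card_le_one.2 fun x hx y hy => (hI hx).trans (hI hy).symm
    have hWa : G.IndepNumOnLE (insert a W) (4 * σ) :=
      (hsmall.union ha1).mono (by rw [Set.union_singleton]) (by omega)
    have hsub : insert a W ⊆ A := Set.insert_subset haA hWA
    have htree := hZ.addLeaf hB₀ (B := insert a W) (by
      rintro v ⟨hv, hvZ⟩
      exact hWB (hZA ⟨hvZ, hsub hv⟩))
    obtain ⟨𝓑', h1, h2, h3, h4⟩ := ih _ (by
        have : (A \ insert a W).ncard < (A \ W).ncard := by
          refine Set.ncard_lt_ncard ⟨Set.sdiff_subset_sdiff_right (Set.subset_insert _ _), ?_⟩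
          intro h
          exact (h ⟨haA, haW⟩).2 (Set.mem_insert _ _)
        omega) A (insert a W) _ _ (insert a W) htree (Set.mem_insert _ _) (by
        rintro B (rfl | hB)
        · exact hWa.mono subset_rfl (by omega)
        · exact hP B hB) hsub subset_rfl (by
        rintro v ⟨hv | hv, hvA⟩
        · exact Or.inr (hZA ⟨hv, hvA⟩)
        · exact hv) hWa rfl
    refine ⟨𝓑', (Set.subset_insert _ _).trans h1, ?_, h3, h4⟩
    rwa [Set.union_assoc, Set.union_eq_right.2 hsub] at h2
  · -- Otherwise split along a separator that is balanced for a maximum independent set of `W`.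
    obtain ⟨J, hJW, hJ, hJc⟩ : ∃ J : Finset V, (J : Set V) ⊆ W ∧ G.IsIndepSet J ∧
        J.card = 4 * σ := by
      unfold IndepNumOnLE at hsmall
      push Not at hsmall
      obtain ⟨J, hJW, hJ, hJc⟩ := hsmall
      have := hW J hJW hJ
      exact ⟨J, hJW, hJ, by omega⟩
    obtain ⟨S, hS, hbal⟩ := hsep J (by omega) hJ
    have hJS : (J.filter (· ∈ S)).card ≤ σ :=
      hS _ (fun u hu => (Finset.mem_filter.1 hu).2)
        (hJ.mono (Finset.coe_subset.2 (Finset.filter_subset _ _)))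
    have hJC : ∀ v ∉ S, (J.filter (· ∈ G.componentAvoiding S v)).card ≤ 2 * σ := by
      intro v hv
      have h := hbal v hv
      have he : ((J : Set V) ∩ G.componentAvoiding S v) =
          ((J.filter (· ∈ G.componentAvoiding S v) : Finset V) : Set V) := by
        ext; simp
      rw [he, Set.ncard_coe_finset] at h
      omega
    set B₁ := W ∪ S ∩ A with hB₁
    have hB₁A : B₁ ⊆ A := Set.union_subset hWA Set.inter_subset_right
    have htree := hZ.addLeaf hB₀ (B := B₁) (by
      rintro v ⟨hv, hvZ⟩
      exact hWB (hZA ⟨hvZ, hB₁A hv⟩))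
    have hB₁P : G.IndepNumOnLE B₁ (5 * σ) :=
      (hW.union (hS.mono Set.inter_subset_left le_rfl)).mono subset_rfl (by omega)
    set 𝒟 : Finset (Set V) := ((Set.toFinite (Sᶜ)).toFinset).image (G.componentAvoiding S) with h𝒟
    have hmem : ∀ C ∈ 𝒟, ∃ v, v ∉ S ∧ G.componentAvoiding S v = C := by
      intro C hC
      simpa [h𝒟] using hC
    obtain ⟨𝓑', h1, h2, h3, h4⟩ := IsBagTree.exists_extend_iUnion (G := G) (A := A) (S := S ∩ A)
      (P := fun B => G.IndepNumOnLE B (5 * σ)) htree (Set.mem_insert _ _) (by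
        rintro B (rfl | hB)
        · exact hB₁P
        · exact hP B hB) 𝒟 (by
        intro C hC C' hC' hne
        obtain ⟨v, -, rfl⟩ := hmem C hC
        obtain ⟨v', -, rfl⟩ := hmem C' hC'
        refine Set.disjoint_left.2 fun u hu hu' => hne ?_
        exact (componentAvoiding_eq hu).symm.trans (componentAvoiding_eq hu')) (by
        rintro C hC v ⟨hv | hv, hv'⟩
        · have hvA : v ∈ A := by
            rcases hv' with h | h <;> exact h.2
          exact Or.inl (hZA ⟨hv, hvA⟩)
        · exact hv) (fun v hv => Or.inr (Or.inr hv)) (by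
        intro C hC Z' 𝓑' hZ' hB₁' hP' hcap
        obtain ⟨v, hv, rfl⟩ := hmem C hC
        have hIC : G.IndepNumOnLE (W ∩ G.componentAvoiding S v ∪ S ∩ A) (4 * σ) := by
          have h : G.IndepNumOnLE (W ∩ G.componentAvoiding S v) (3 * σ) := by
            intro I hI hIi
            have := card_le_add_card_filter_componentAvoiding hS hW hJW hJ hJc hv hI hIi
            have := hJC v hv
            omega
          exact (h.union (hS.mono Set.inter_subset_left le_rfl)).mono subset_rfl (by omega)
        refine ih _ ?_ _ (W ∩ G.componentAvoiding S v ∪ S ∩ A) _ _ B₁ hZ' hB₁' hP' ?_ ?_ ?_ hIC rfl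
        · -- A vertex of `J` outside `S` and outside the component is lost.
          have hlt : (G.componentAvoiding S v ∩ A ∪ S ∩ A).ncard < A.ncard := by
            refine Set.ncard_lt_ncard ⟨Set.union_subset Set.inter_subset_right
              Set.inter_subset_right, fun h => ?_⟩
            have hJle : J ⊆ J.filter (· ∈ S) ∪ J.filter (· ∈ G.componentAvoiding S v) := by
              intro u hu
              simp only [Finset.mem_union, Finset.mem_filter]
              rcases h (hWA (hJW hu)) with h | h
              · exact Or.inr ⟨hu, h.1⟩
              · exact Or.inl ⟨hu, h.1⟩
            have := (Finset.card_le_card hJle).trans (Finset.card_union_le _ _)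
            have := hJC v hv
            omega
          have hle : ((G.componentAvoiding S v ∩ A ∪ S ∩ A) \
              (W ∩ G.componentAvoiding S v ∪ S ∩ A)).ncard ≤ (A \ W).ncard := by
            refine Set.ncard_le_ncard ?_
            rintro u ⟨hu | hu, hu'⟩
            · exact ⟨hu.2, fun h => hu' (Or.inl ⟨h, hu.1⟩)⟩
            · exact (hu' (Or.inr hu)).elim
          omega
        · rintro u (hu | hu)
          · exact Or.inl ⟨hu.2, hWA hu.1⟩
          · exact Or.inr hu
        · rintro u (hu | hu)
          · exact Or.inl hu.1
          · exact Or.inr hu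
        · rintro u hu
          rcases hu.2 with h | h
          · rcases hcap hu with h' | h'
            · exact Or.inl ⟨h', h.1⟩
            · exact Or.inr h'
          · exact Or.inr h)
    refine ⟨𝓑', (Set.subset_insert _ _).trans h1, ?_, h3, ?_⟩
    · convert h2 using 1
      ext u
      constructor
      · rintro (hu | hu)
        · exact Or.inl (Or.inl hu)
        · by_cases huS : u ∈ S
          · exact Or.inl (Or.inr (Or.inr ⟨huS, hu⟩))
          · refine Or.inr (Set.mem_iUnion₂.2 ⟨G.componentAvoiding S u, ?_,
              mem_componentAvoiding_self _ _, hu⟩)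
            exact Finset.mem_image_of_mem _ (by simpa using huS)
      · rintro ((hu | hu) | hu)
        · exact Or.inl hu
        · exact Or.inr (hB₁A hu)
        · obtain ⟨C, -, hu⟩ := Set.mem_iUnion₂.1 hu
          exact Or.inr hu.2
    · have key : ∀ u ∈ A, ∀ v ∈ A, u ∉ S → G.Adj u v → ∃ B ∈ 𝓑', u ∈ B ∧ v ∈ B := by
        intro u hu v hv huS huv
        refine h4 (G.componentAvoiding S u) (Finset.mem_image_of_mem _ (by simpa using huS)) u
          (Or.inl ⟨mem_componentAvoiding_self _ _, hu⟩) v ?_ huv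
        by_cases hvS : v ∈ S
        · exact Or.inr ⟨hvS, hv⟩
        · exact Or.inl ⟨Relation.ReflTransGen.single ⟨huv, huS, hvS⟩, hv⟩
      intro u hu v hv huv
      by_cases huS : u ∈ S
      · by_cases hvS : v ∈ S
        · exact ⟨B₁, h1 (Set.mem_insert _ _), Or.inr ⟨huS, hu⟩, Or.inr ⟨hvS, hv⟩⟩
        · obtain ⟨B, hB, h, h'⟩ := key v hv u hu hvS huv.symm
          exact ⟨B, hB, h', h⟩
      · exact key u hu v hv huS huv

/-- Balanced separators of independence number at most `σ` for all independent sets give a tree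
decomposition with bags of independence number at most `5σ`. -/
theorem exists_treeDecomposition_of_balanced [Finite V] {σ : ℕ} (hσ : 0 < σ)
    (hsep : ∀ J : Finset V, 2 ≤ J.card → G.IsIndepSet J → ∃ S : Set V, G.IndepNumOnLE S σ ∧
      ∀ v ∉ S, 2 * ((J : Set V) ∩ G.componentAvoiding S v).ncard ≤ J.card) :
    ∃ T : G.TreeDecomposition, ∀ x, G.IndepNumOnLE (T.bag x) (5 * σ) := by
  have h0 : ∀ n, G.IndepNumOnLE ∅ n := by
    intro n I hI _
    simp [Finset.coe_eq_empty.1 (Set.subset_empty_iff.1 hI)]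
  obtain ⟨𝓑, -, hT, hP, hedge⟩ := IsBagTree.exists_extend hσ hsep Set.univ ∅ ∅ {∅} ∅
    isBagTree_empty rfl (by rintro B rfl; exact h0 _) (Set.empty_subset _) subset_rfl
    (by simp) (h0 _)
  obtain ⟨N, hN, T, bag, htree, rfl, -, hconn⟩ := hT
  refine ⟨⟨N, hN, T, htree, bag, ?_, fun v => hconn v (Or.inr trivial)⟩, fun x => hP _ ⟨x, rfl⟩⟩
  intro u v huv
  obtain ⟨_, ⟨x, rfl⟩, h⟩ := hedge u trivial v trivial huv
  exact ⟨x, h⟩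

/-! ### Balanced separators from a tree decomposition -/

/-- A Helly property of trees. If every node `x` misses some `F x`, and `F x` is connected in
`T - x`, then two of the sets `F x` are disjoint. Indeed, orient at each node `x` the edge towards
`F x`. A tree has fewer edges than nodes, so some edge is oriented from both of its ends, and
the two corresponding sets lie on different sides of it. -/
theorem IsTree.exists_disjoint_of_forall_notMem {N : Type*} [Finite N] {T : SimpleGraph N}
    (hT : T.IsTree) (F : N → Set N) (hne : ∀ x, (F x).Nonempty) (hF : ∀ x, x ∉ F x)
    (hconn : ∀ x, ∀ a ∈ F x, ∀ b ∈ F x, (T.deleteEdges {e | x ∈ e}).Reachable a b) :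
    ∃ x y, Disjoint (F x) (F y) := by
  by_contra! hcon
  have hdir : ∀ x, ∃ y, T.Adj x y ∧ ∀ b ∈ F x, (T.deleteEdges {e | x ∈ e}).Reachable y b := by
    intro x
    obtain ⟨c, hc⟩ := hne x
    obtain ⟨p, hp⟩ := (hT.connected.preconnected x c).exists_isPath
    cases p with
    | nil => exact (hF x hc).elim
    | @cons _ y _ h q =>
      rw [Walk.cons_isPath_iff] at hp
      have hq : ∀ e ∈ q.edges, e ∉ {e : Sym2 N | x ∈ e} := fun e he hx =>
        hp.2 (q.mem_support_of_mem_edges he hx)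
      exact ⟨y, h, fun b hb => (q.toDeleteEdges _ hq).reachable.trans (hconn x c hc b hb)⟩
  choose f hadj hf using hdir
  let g : N → T.edgeSet := fun x => ⟨s(x, f x), hadj x⟩
  have hg : ¬ Function.Injective g := by
    intro hg
    have := Nat.card_le_card_of_injective g hg
    have := (isTree_iff_connected_and_card.1 hT).2
    omega
  obtain ⟨x, y, hxy, hne⟩ := Function.not_injective_iff.1 hg
  have hxy' : s(x, f x) = s(y, f y) := congrArg Subtype.val hxy
  obtain ⟨rfl, -⟩ : f x = y ∧ x = f y := by
    rw [Sym2.eq_iff] at hxy'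
    rcases hxy' with h | h
    · exact (hne h.1).elim
    · exact ⟨h.2, h.1⟩
  have hfx : f (f x) = x := by
    rw [Sym2.eq_iff] at hxy'
    rcases hxy' with h | h
    · exact (hne h.1).elim
    · exact h.1.symm
  obtain ⟨b, hb, hb'⟩ := Set.not_disjoint_iff.1 (hcon x (f x))
  have h1 := hf x b hb
  have h2 := hf (f x) b hb'
  rw [hfx] at h2
  have hbridge := isAcyclic_iff_forall_adj_isBridge.1 hT.isAcyclic (hadj x)
  rw [isBridge_iff] at hbridge
  refine hbridge ((h2.mono ?_).trans (h1.mono ?_).symm) <;>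
  · refine deleteEdges_anti ?_
    rintro e rfl
    simp

/-- If every bag `X` of a tree decomposition comes with a set `S` such that the vertices of
`X \ S` are isolated in `G - S`, then one of these sets `S` separates a given set `J` of at least
two vertices in a balanced way. -/
theorem TreeDecomposition.exists_balanced (T : G.TreeDecomposition) (S : T.Node → Set V)
    (hS : ∀ x, ∀ v ∈ T.bag x, v ∉ S x → ∀ u, G.Adj v u → u ∈ S x) (J : Finset V)
    (hJ : 2 ≤ J.card) :
    ∃ x, ∀ v ∉ S x, 2 * ((J : Set V) ∩ G.componentAvoiding (S x) v).ncard ≤ J.card := by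
  classical
  by_contra! hcon
  choose v hvS hv using hcon
  set C : T.Node → Set V := fun x => G.componentAvoiding (S x) (v x) with hC
  replace hv : ∀ x, J.card < 2 * ((J : Set V) ∩ C x).ncard := hv
  have hfin : ∀ x, ((J : Set V) ∩ C x).Finite := fun x => J.finite_toSet.inter_of_left _
  have : Finite T.Node := T.finite_node
  -- Components are nontrivial, hence avoid the bag.
  have havoid : ∀ x, ∀ u ∈ C x, u ∉ T.bag x := by
    intro x u hu hux
    have huS : u ∉ S x := notMem_of_mem_componentAvoiding (hvS x) hu
    have hsub : C x ⊆ {u} := by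
      intro w hw
      rw [show C x = _ from (componentAvoiding_eq hu).symm] at hw
      rcases Relation.ReflTransGen.cases_head hw with h | ⟨a, ha, -⟩
      · exact h.symm
      · exact (ha.2.2 (hS x u hux huS a ha.1)).elim
    have h1 : ((J : Set V) ∩ C x).ncard ≤ 1 := by
      rw [← Set.ncard_singleton u]
      exact Set.ncard_le_ncard (Set.inter_subset_right.trans hsub) (Set.finite_singleton u)
    have := hv x
    omega
  have hsubtree : ∀ x u, u ∉ T.bag x → ∀ a b, u ∈ T.bag a → u ∈ T.bag b →
      (T.tree.deleteEdges {e | x ∈ e}).Reachable a b := by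
    intro x u hux a b ha hb
    let f : T.tree.induce {y | u ∈ T.bag y} →g T.tree.deleteEdges {e | x ∈ e} :=
      { toFun := Subtype.val
        map_rel' := fun {y z} hyz => by
          rw [deleteEdges_adj]
          refine ⟨hyz, fun hx => ?_⟩
          rcases Sym2.mem_iff.1 hx with h | h
          · exact hux (h ▸ y.2)
          · exact hux (h ▸ z.2) }
    exact ((T.connected_induce u).preconnected ⟨a, ha⟩ ⟨b, hb⟩).map f
  have hbag : ∀ u, ∃ y, u ∈ T.bag y := fun u => by
    obtain ⟨y, hy⟩ := (T.connected_induce u).nonempty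
    exact ⟨y, hy⟩
  obtain ⟨x, y, hxy⟩ := T.isTree.exists_disjoint_of_forall_notMem
    (fun x => {y | ∃ u ∈ C x, u ∈ T.bag y})
    (fun x => by
      obtain ⟨y, hy⟩ := hbag (v x)
      exact ⟨y, v x, mem_componentAvoiding_self _ _, hy⟩)
    (fun x ⟨u, hu, hux⟩ => havoid x u hu hux)
    (fun x => by
      obtain ⟨y₀, hy₀⟩ := hbag (v x)
      have key : ∀ u ∈ C x, ∀ y, u ∈ T.bag y →
          (T.tree.deleteEdges {e | x ∈ e}).Reachable y₀ y := by
        intro u hu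
        have hu' := hu
        induction hu with
        | refl => exact fun y hy => hsubtree x (v x) (havoid x _ hu') y₀ y hy₀ hy
        | @tail a b ha hab ih =>
          intro y hy
          obtain ⟨z, hza, hzb⟩ := T.exists_bag_of_adj a b hab.1
          exact (ih ha z hza).trans (hsubtree x b (havoid x b hu') z y hzb hy)
      rintro a ⟨u, hu, ha⟩ b ⟨w, hw, hb⟩
      exact (key u hu a ha).symm.trans (key w hw b hb))
  -- Two components with more than half of `J` intersect.
  have hdisj : Disjoint ((J : Set V) ∩ C x) ((J : Set V) ∩ C y) := by
    refine Set.disjoint_left.2 fun u hu hu' => ?_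
    obtain ⟨z, hz⟩ := hbag u
    exact Set.disjoint_left.1 hxy ⟨u, hu.2, hz⟩ ⟨u, hu'.2, hz⟩
  have h1 := Set.ncard_union_eq hdisj (hfin x) (hfin y)
  have h2 : ((J : Set V) ∩ C x ∪ (J : Set V) ∩ C y).ncard ≤ J.card := by
    rw [← Set.ncard_coe_finset J]
    exact Set.ncard_le_ncard (Set.union_subset Set.inter_subset_left Set.inter_subset_left)
      J.finite_toSet
  have := hv x
  have := hv y
  omega

/-! ### Induced matchings in graphs without induced `K_{t,t}` -/

theorem isIndContained_completeBipartiteGraph_of_card {t : ℕ} {A B : Finset V} (hA : G.IsIndepSet A)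
    (hB : G.IsIndepSet B) (hAB : ∀ a ∈ A, ∀ b ∈ B, G.Adj a b) (hAt : t ≤ A.card)
    (hBt : t ≤ B.card) : (completeBipartiteGraph (Fin t) (Fin t)).IsIndContained G := by
  let f : Fin t ↪ A := (Fin.castLEEmb hAt).trans A.equivFin.symm.toEmbedding
  let g : Fin t ↪ B := (Fin.castLEEmb hBt).trans B.equivFin.symm.toEmbedding
  have hfg : ∀ i j, G.Adj (f i) (g j) := fun i j => hAB _ (f i).2 _ (g j).2
  have hind : ∀ {S : Finset V}, G.IsIndepSet S → ∀ a b : S, ¬ G.Adj a b := fun hS a b hab =>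
    hS a.2 b.2 hab.ne hab
  refine ⟨⟨⟨Sum.elim (fun i => (f i : V)) (fun j => (g j : V)), ?_⟩, ?_⟩⟩
  · refine Function.Injective.sumElim (Subtype.val_injective.comp f.injective)
      (Subtype.val_injective.comp g.injective) fun i j => (hfg i j).ne
  · rintro (i | i) (j | j)
    · simpa using hind hA (f i) (f j)
    · simpa using hfg i j
    · simpa using (hfg j i).symm
    · simpa using hind hB (g i) (g j)

open Classical in
/-- A form of the Kővári–Sós–Turán theorem: without induced `K_{t,t}`, fewer than `L` vertices of an
independent set `A` have at least `d` neighbours in an independent set `B`, if `d ≥ t|B|/L` and `B`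
is large in terms of `t` and `L`. -/
theorem card_lt_of_forall_le_card_neighbors {t L d : ℕ}
    (hfree : ¬ (completeBipartiteGraph (Fin t) (Fin t)).IsIndContained G) (ht : 0 < t) (hL : 0 < L)
    {A B : Finset V} (hA : G.IsIndepSet A) (hB : G.IsIndepSet B) (hd : t * B.card ≤ L * d)
    (hBL : t * L ^ (t + 1) ≤ B.card) (hAB : ∀ a ∈ A, d ≤ (B.filter (G.Adj a ·)).card) :
    A.card < L := by
  by_contra! hAL
  obtain ⟨A', hA'A, hA'⟩ := Finset.exists_subset_card_eq hAL
  have hA'i : G.IsIndepSet A' := hA.mono (Finset.coe_subset.2 hA'A)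
  -- Many vertices of `B` have at least `t` neighbours in `A'`.
  set β := B.filter (fun b => t ≤ (A'.filter (G.Adj · b)).card) with hβ
  have h1 : L * d ≤ ∑ b ∈ B, (A'.filter (G.Adj · b)).card := by
    calc L * d = ∑ _a ∈ A', d := by simp [hA']
      _ ≤ ∑ a ∈ A', (B.filter (G.Adj a ·)).card := Finset.sum_le_sum fun a ha => hAB a (hA'A ha)
      _ = _ := Finset.sum_card_bipartiteAbove_eq_sum_card_bipartiteBelow G.Adj
  have h2 : ∑ b ∈ B, (A'.filter (G.Adj · b)).card ≤ (t - 1) * B.card + L * β.card := by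
    calc ∑ b ∈ B, (A'.filter (G.Adj · b)).card
        ≤ ∑ b ∈ B, ((t - 1) + if t ≤ (A'.filter (G.Adj · b)).card then L else 0) := by
          refine Finset.sum_le_sum fun b _ => ?_
          split_ifs with h
          · exact (Finset.card_filter_le _ _).trans (by omega)
          · omega
      _ = _ := by
          rw [Finset.sum_add_distrib, ← Finset.sum_filter]
          simp [hβ, mul_comm]
  have h3 : L * (t * L ^ t) ≤ L * β.card := by
    have h4 : t * B.card = (t - 1) * B.card + B.card := by
      obtain ⟨s, rfl⟩ := Nat.exists_eq_succ_of_ne_zero ht.ne'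
      simp [Nat.succ_mul]
    have h5 : L * (t * L ^ t) = t * L ^ (t + 1) := by ring
    omega
  have hβc : t * L ^ t ≤ β.card := Nat.le_of_mul_le_mul_left h3 hL
  -- By the pigeonhole principle, `t` of them share `t` neighbours.
  have hsub : ∀ b, ∃ Q : Finset V, b ∈ β → Q ⊆ A'.filter (G.Adj · b) ∧ Q.card = t := by
    intro b
    by_cases hb : b ∈ β
    · obtain ⟨Q, hQ⟩ := Finset.exists_subset_card_eq (Finset.mem_filter.1 hb).2
      exact ⟨Q, fun _ => hQ⟩
    · exact ⟨∅, fun h => (hb h).elim⟩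
  choose φ hφ using hsub
  have hmaps : ∀ b ∈ β, φ b ∈ A'.powersetCard t := fun b hb =>
    Finset.mem_powersetCard.2 ⟨(hφ b hb).1.trans (Finset.filter_subset _ _), (hφ b hb).2⟩
  have hβne : β.Nonempty := Finset.card_pos.1 (lt_of_lt_of_le (by positivity) hβc)
  obtain ⟨b₀, hb₀⟩ := hβne
  have hcard : (A'.powersetCard t).card * t ≤ β.card := by
    rw [Finset.card_powersetCard, hA', mul_comm]
    exact (Nat.mul_le_mul_left t (Nat.choose_le_pow L t)).trans hβc
  obtain ⟨Q, hQ, hQt⟩ := Finset.exists_le_card_fiber_of_mul_le_card_of_maps_to hmaps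
    ⟨_, hmaps b₀ hb₀⟩ hcard
  rw [Finset.mem_powersetCard] at hQ
  refine hfree (isIndContained_completeBipartiteGraph_of_card
    (hA'i.mono (Finset.coe_subset.2 hQ.1))
    (hB.mono (Finset.coe_subset.2 ((Finset.filter_subset _ _).trans (Finset.filter_subset _ _))))
    ?_ hQ.2.ge hQt)
  intro a ha b hb
  obtain ⟨hbβ, hbQ⟩ := Finset.mem_filter.1 hb
  exact (Finset.mem_filter.1 ((hφ b hbβ).1 (hbQ ▸ ha))).2

/-- A digraph with all out-degrees at most `d` on more than `k(2d+1)` vertices has `k + 1` pairwise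
nonadjacent vertices. -/
theorem exists_card_eq_of_outDegree_le {α : Type*} [DecidableEq α] (R : α → α → Prop)
    [DecidableRel R] {d : ℕ} (k : ℕ)
    (s : Finset α) (hd : ∀ i ∈ s, (s.filter (fun j => j ≠ i ∧ R i j)).card ≤ d)
    (hs : k * (2 * d + 1) < s.card) :
    ∃ K ⊆ s, K.card = k + 1 ∧ ∀ i ∈ K, ∀ j ∈ K, i ≠ j → ¬ R i j := by
  induction k generalizing s with
  | zero =>
    obtain ⟨a, ha⟩ := Finset.card_pos.1 (by simpa using hs)
    refine ⟨{a}, by simpa using ha, by simp, ?_⟩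
    intro i hi j hj hne
    exact (hne ((Finset.mem_singleton.1 hi).trans (Finset.mem_singleton.1 hj).symm)).elim
  | succ k ih =>
    -- Some vertex has in-degree at most `d`.
    obtain ⟨a, ha, hain⟩ : ∃ a ∈ s, (s.filter (fun j => a ≠ j ∧ R j a)).card ≤ d := by
      refine Finset.exists_le_of_sum_le (g := fun _ => d)
        (Finset.card_pos.1 (lt_of_le_of_lt (Nat.zero_le _) hs)) ?_
      have := Finset.sum_card_bipartiteAbove_eq_sum_card_bipartiteBelow (s := s) (t := s)
        (fun i j => j ≠ i ∧ R i j)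
      simp only [Finset.bipartiteAbove, Finset.bipartiteBelow] at this
      rw [← this]
      exact Finset.sum_le_sum hd
    set out := s.filter (fun j => j ≠ a ∧ R a j) with hout
    set inn := s.filter (fun j => a ≠ j ∧ R j a) with hinn
    have hbad : (insert a (out ∪ inn)).card ≤ 2 * d + 1 := by
      have h1 := Finset.card_insert_le a (out ∪ inn)
      have h2 := Finset.card_union_le out inn
      have h3 : out.card ≤ d := hd a ha
      omega
    have hcard := Finset.le_card_sdiff (insert a (out ∪ inn)) s
    obtain ⟨K, hKs, hK, hKR⟩ := ih (s \ insert a (out ∪ inn))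
      (fun i hi => (Finset.card_le_card (Finset.filter_subset_filter _ Finset.sdiff_subset)).trans
        (hd i (Finset.mem_sdiff.1 hi).1))
      (by rw [Nat.succ_mul] at hs; omega)
    have hKs' : ∀ j ∈ K, j ∈ s ∧ j ≠ a ∧ ¬ R a j ∧ ¬ R j a := by
      intro j hj
      have := hKs hj
      simp only [hout, hinn, Finset.mem_sdiff, Finset.mem_insert, Finset.mem_union,
        Finset.mem_filter, not_or] at this
      obtain ⟨h1, h2, h3, h4⟩ := this
      exact ⟨h1, h2, fun h => h3 ⟨h1, h2, h⟩, fun h => h4 ⟨h1, Ne.symm h2, h⟩⟩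
    refine ⟨insert a K, ?_, ?_, ?_⟩
    · exact Finset.insert_subset ha fun j hj => (hKs' j hj).1
    · rw [Finset.card_insert_of_notMem (fun h => (hKs' a h).2.1 rfl), hK]
    · intro i hi j hj hne
      rcases Finset.mem_insert.1 hi with hi' | hi' <;> rcases Finset.mem_insert.1 hj with hj' | hj'
      · exact (hne (hi'.trans hj'.symm)).elim
      · exact hi' ▸ (hKs' j hj').2.2.1
      · exact hj' ▸ (hKs' i hi').2.2.2
      · exact hKR i hi' j hj' hne

/-- Every induced matching of `G` whose edges all meet `X` has at most `k` edges. -/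
def InducedMatchingNumOnLE (G : SimpleGraph V) (X : Set V) (k : ℕ) : Prop :=
  ∀ M : Finset (Sym2 V), G.IsInducedMatchingIn M → (∀ e ∈ M, ∃ v ∈ e, v ∈ X) → M.card ≤ k

theorem inducedMatchingNumOnLE_of_inducedMatchingNumOn_le [Finite V] {X : Set V} {k : ℕ}
    (h : G.inducedMatchingNumOn X ≤ k) : G.InducedMatchingNumOnLE X k := by
  intro M hM hX
  have : M.card ≤ G.inducedMatchingNumOn X := le_csSup ?_ ⟨M, hM, hX, rfl⟩
  · exact this.trans h
  refine ((Set.finite_range (Finset.card : Finset (Sym2 V) → ℕ)).subset ?_).bddAbove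
  rintro _ ⟨M, -, -, rfl⟩
  exact ⟨M, rfl⟩

/-- The edges `v w(v)`, `v ∈ K`, form an induced matching if `K` is independent and there are no
edges `v w(v')` or `w(v) w(v')` for distinct `v, v' ∈ K`. -/
theorem InducedMatchingNumOnLE.card_le {X : Set V} {k : ℕ} (h : G.InducedMatchingNumOnLE X k)
    {K : Finset V} {w : V → V} (hK : G.IsIndepSet K) (hw : ∀ v ∈ K, G.Adj v (w v))
    (hX : ∀ v ∈ K, v ∈ X ∨ w v ∈ X) (hvw : ∀ v ∈ K, ∀ v' ∈ K, v ≠ v' → ¬ G.Adj v (w v'))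
    (hww : ∀ v ∈ K, ∀ v' ∈ K, v ≠ v' → ¬ G.Adj (w v) (w v')) : K.card ≤ k := by
  classical
  have hne : ∀ v ∈ K, ∀ v' ∈ K, v ≠ w v' := by
    intro v hv v' hv' h
    have hadj := hw v' hv'
    rw [← h] at hadj
    exact hK hv' hv hadj.ne hadj
  have hinj : Set.InjOn (fun v => s(v, w v)) (K : Set V) := by
    intro v hv v' hv' he
    rcases Sym2.eq_iff.1 he with h | h
    · exact h.1
    · exact (hne v hv v' hv' h.1).elim
  rw [← Finset.card_image_of_injOn hinj]
  refine h _ ⟨⟨?_, ?_⟩, ?_⟩ ?_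
  · intro e he
    obtain ⟨v, hv, rfl⟩ := Finset.mem_image.1 he
    exact hw v hv
  · intro e he f hf hef x hxe hxf
    obtain ⟨v, hv, rfl⟩ := Finset.mem_image.1 he
    obtain ⟨v', hv', rfl⟩ := Finset.mem_image.1 hf
    have hvv' : v ≠ v' := fun h => hef (by rw [h])
    rcases Sym2.mem_iff.1 hxe with rfl | rfl <;> rcases Sym2.mem_iff.1 hxf with h | h
    · exact hvv' h
    · exact hne _ hv _ hv' h
    · exact hne _ hv' _ hv h.symm
    · exact hvw v' hv' v hv hvv'.symm (h ▸ hw v' hv')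
  · intro e he f hf hef x hxe y hyf
    obtain ⟨v, hv, rfl⟩ := Finset.mem_image.1 he
    obtain ⟨v', hv', rfl⟩ := Finset.mem_image.1 hf
    have hvv' : v ≠ v' := fun h => hef (by rw [h])
    rcases Sym2.mem_iff.1 hxe with rfl | rfl <;> rcases Sym2.mem_iff.1 hyf with rfl | rfl
    · exact hK hv hv' hvv'
    · exact hvw _ hv _ hv' hvv'
    · exact fun h => hvw _ hv' _ hv hvv'.symm h.symm
    · exact hww _ hv _ hv' hvv'
  · intro e he
    obtain ⟨v, hv, rfl⟩ := Finset.mem_image.1 he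
    rcases hX v hv with h | h
    · exact ⟨v, Sym2.mem_mk_left _ _, h⟩
    · exact ⟨w v, Sym2.mem_mk_right _ _, h⟩

open Classical in
/-- Greedy choice of private neighbours `w v ∈ I v`, one vertex `v ∈ K` after the other. Vertices of
`I v` are avoided if they are adjacent to another vertex of `K`, to a neighbour chosen before, or to
at least `d` vertices of another set `I v'`. -/
theorem exists_private_neighbors {k L d D : ℕ} (hD : k * (2 * d + L) < D) {K : Finset V}
    (hK : K.card = k + 1) {I : V → Finset V} (hI : ∀ v ∈ K, (I v).card = D)
    (hKd : ∀ v ∈ K, ∀ v' ∈ K, v ≠ v' → ((I v).filter (G.Adj v' ·)).card ≤ d)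
    (hL : ∀ v ∈ K, ∀ v' ∈ K, v ≠ v' →
      ((I v).filter (fun a => d ≤ ((I v').filter (G.Adj a ·)).card)).card ≤ L)
    {K' : Finset V} (hK' : K' ⊆ K) :
    ∃ w : V → V, ∀ v ∈ K', w v ∈ I v ∧
      (∀ v' ∈ K, v ≠ v' → ¬ G.Adj v' (w v) ∧ ((I v').filter (G.Adj (w v) ·)).card ≤ d) ∧
      ∀ v' ∈ K', v ≠ v' → ¬ G.Adj (w v) (w v') := by
  induction K' using Finset.induction_on with
  | empty => exact ⟨id, by simp⟩
  | insert v K' hv ih =>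
    obtain ⟨w, hw⟩ := ih ((Finset.subset_insert _ _).trans hK')
    have hvK : v ∈ K := hK' (Finset.mem_insert_self _ _)
    have hK'v : K' ⊆ K.erase v := fun v' hv' => Finset.mem_erase.2
      ⟨fun h => hv (h ▸ hv'), hK' (Finset.mem_insert_of_mem hv')⟩
    have hKv : (K.erase v).card = k := by rw [Finset.card_erase_of_mem hvK, hK]; rfl
    set bad := (K.erase v).biUnion (fun v' => (I v).filter (G.Adj v' ·)) ∪
      (K.erase v).biUnion (fun v' => (I v).filter
        (fun a => d ≤ ((I v').filter (G.Adj a ·)).card)) ∪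
      K'.biUnion (fun v' => (I v).filter (G.Adj (w v') ·)) with hbad
    have h1 : ((K.erase v).biUnion (fun v' => (I v).filter (G.Adj v' ·))).card ≤ k * d := by
      rw [← hKv]
      exact Finset.card_biUnion_le_card_mul _ _ _ fun v' hv' =>
        hKd v hvK v' (Finset.mem_of_mem_erase hv') (Finset.ne_of_mem_erase hv').symm
    have h2 : ((K.erase v).biUnion (fun v' => (I v).filter
        (fun a => d ≤ ((I v').filter (G.Adj a ·)).card))).card ≤ k * L := by
      rw [← hKv]
      exact Finset.card_biUnion_le_card_mul _ _ _ fun v' hv' =>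
        hL v hvK v' (Finset.mem_of_mem_erase hv') (Finset.ne_of_mem_erase hv').symm
    have h3 : (K'.biUnion (fun v' => (I v).filter (G.Adj (w v') ·))).card ≤ k * d := by
      refine (Finset.card_biUnion_le_card_mul _ _ d fun v' hv' => ?_).trans
        (Nat.mul_le_mul_right d (hKv ▸ Finset.card_le_card hK'v))
      exact ((hw v' hv').2.1 v hvK (fun h => hv (h ▸ hv'))).2
    have hlt : bad.card < (I v).card := by
      have h4 : bad.card ≤ _ := Finset.card_union_le
        ((K.erase v).biUnion (fun v' => (I v).filter (G.Adj v' ·)) ∪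
        (K.erase v).biUnion (fun v' => (I v).filter
          (fun a => d ≤ ((I v').filter (G.Adj a ·)).card)))
        (K'.biUnion (fun v' => (I v).filter (G.Adj (w v') ·)))
      have h5 := Finset.card_union_le ((K.erase v).biUnion (fun v' => (I v).filter (G.Adj v' ·)))
        ((K.erase v).biUnion (fun v' => (I v).filter
          (fun a => d ≤ ((I v').filter (G.Adj a ·)).card)))
      have h6 : k * (2 * d + L) = k * d + k * L + k * d := by ring
      rw [hI v hvK]
      omega
    obtain ⟨a, haI, ha⟩ := Finset.exists_mem_notMem_of_card_lt_card hlt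
    simp only [hbad, Finset.mem_union, Finset.mem_biUnion, Finset.mem_filter, not_or, not_exists,
      not_and, Finset.mem_erase, not_le] at ha
    obtain ⟨⟨ha1, ha2⟩, ha3⟩ := ha
    have hne : ∀ v' ∈ K', v' ≠ v := fun v' hv' h => hv (h ▸ hv')
    refine ⟨Function.update w v a, ?_⟩
    intro x hx
    rcases Finset.mem_insert.1 hx with rfl | hx'
    · rw [Function.update_self]
      refine ⟨haI, fun v' hv' hvv' => ⟨ha1 v' ⟨hvv'.symm, hv'⟩ haI,
        (ha2 v' ⟨hvv'.symm, hv'⟩ haI).le⟩, fun v' hv' hvv' => ?_⟩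
      rcases Finset.mem_insert.1 hv' with rfl | hv'
      · exact (hvv' rfl).elim
      · rw [Function.update_of_ne (hne v' hv')]
        exact fun h => ha3 v' hv' haI h.symm
    · rw [Function.update_of_ne (hne x hx')]
      refine ⟨(hw x hx').1, (hw x hx').2.1, fun v' hv' hvv' => ?_⟩
      rcases Finset.mem_insert.1 hv' with rfl | hv'
      · rw [Function.update_self]
        exact ha3 x hx' haI
      · rw [Function.update_of_ne (hne v' hv')]
        exact (hw x hx').2.2 v' hv' hvv'

/-- Vertices with an independent set of `D` neighbours, joined to them by edges that meet `X`, span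
few independent vertices only: otherwise an induced matching of more than `k` edges meeting `X`
could be chosen among these edges. -/
theorem InducedMatchingNumOnLE.indepNumOnLE_of_high {t k L d D : ℕ} {X : Set V}
    (hX : G.InducedMatchingNumOnLE X k)
    (hfree : ¬ (completeBipartiteGraph (Fin t) (Fin t)).IsIndContained G) (ht : 0 < t) (hL : 0 < L)
    (hd : t * D ≤ L * d) (hDL : t * L ^ (t + 1) ≤ D) (hD : k * (2 * d + L) < D) {Q : Set V}
    (hQ : ∀ v ∈ Q, ∃ I : Finset V, G.IsIndepSet I ∧ I.card = D ∧
      ∀ w ∈ I, G.Adj v w ∧ (v ∈ X ∨ w ∈ X)) : G.IndepNumOnLE Q (k * (2 * L + 1)) := by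
  classical
  intro A hAQ hA
  by_contra! hcard
  have hQ' : ∀ v, ∃ I : Finset V, v ∈ Q → G.IsIndepSet I ∧ I.card = D ∧
      ∀ w ∈ I, G.Adj v w ∧ (v ∈ X ∨ w ∈ X) := by
    intro v
    by_cases hv : v ∈ Q
    · obtain ⟨I, hI⟩ := hQ v hv
      exact ⟨I, fun _ => hI⟩
    · exact ⟨∅, fun h => (hv h).elim⟩
  choose I hI using hQ'
  -- Few vertices of an independent set have at least `d` neighbours in `I v`.
  have hKST : ∀ v ∈ A, ∀ B : Finset V, G.IsIndepSet B →
      (B.filter (fun a => d ≤ ((I v).filter (G.Adj a ·)).card)).card ≤ L := by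
    intro v hv B hB
    obtain ⟨hIi, hIc, -⟩ := hI v (hAQ hv)
    refine (card_lt_of_forall_le_card_neighbors hfree ht hL
      (hB.mono (Finset.coe_subset.2 (Finset.filter_subset _ _))) hIi (by rwa [hIc])
      (by rwa [hIc]) (d := d) ?_).le
    intro a ha
    exact (Finset.mem_filter.1 ha).2
  obtain ⟨K, hKA, hK, hKR⟩ := exists_card_eq_of_outDegree_le
    (fun v v' => d ≤ ((I v).filter (G.Adj v' ·)).card) k A (d := L) (fun v hv => by
      refine (Finset.card_le_card ?_).trans (hKST v hv A hA)
      intro v' hv'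
      rw [Finset.mem_filter] at hv' ⊢
      exact ⟨hv'.1, hv'.2.2⟩) hcard
  obtain ⟨w, hw⟩ := exists_private_neighbors hD hK (fun v hv => (hI v (hAQ (hKA hv))).2.1)
    (fun v hv v' hv' hne => (not_le.1 (hKR v hv v' hv' hne)).le)
    (fun v hv v' hv' _ => hKST v' (hKA hv') (I v) (hI v (hAQ (hKA hv))).1) subset_rfl
  have hwI : ∀ v ∈ K, G.Adj v (w v) ∧ (v ∈ X ∨ w v ∈ X) := fun v hv =>
    (hI v (hAQ (hKA hv))).2.2 _ (hw v hv).1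
  have := hX.card_le (hA.mono (Finset.coe_subset.2 hKA)) (fun v hv => (hwI v hv).1)
    (fun v hv => (hwI v hv).2)
    (fun v hv v' hv' hne => ((hw v' hv').2.1 v hv hne.symm).1)
    (fun v hv v' hv' hne => (hw v hv).2.2 v' hv' hne)
  omega

/-! ### Replacing a bag by a separator of small independence number -/

/-- The vertices `m` and their neighbours in `X`, for `m` in a set of `n` vertices each with fewer
than `D` independent neighbours in `X`, span at most `nD` independent vertices. -/
theorem indepNumOnLE_closedNeighbors {X : Set V} {D n : ℕ} (hD : 0 < D) {N : Finset V}
    (hN : N.card ≤ n)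
    (hlow : ∀ m ∈ N, ∀ I : Finset V, G.IsIndepSet I → (∀ w ∈ I, G.Adj m w ∧ w ∈ X) → I.card < D) :
    G.IndepNumOnLE {v | v ∈ X ∧ ∃ m ∈ N, v = m ∨ G.Adj m v} (n * D) := by
  classical
  intro I hI hIi
  have hsub : I ⊆ N.biUnion (fun m => I.filter (fun v => v = m ∨ G.Adj m v)) := by
    intro v hv
    obtain ⟨-, m, hm, h⟩ := hI hv
    exact Finset.mem_biUnion.2 ⟨m, hm, Finset.mem_filter.2 ⟨hv, h⟩⟩
  refine (Finset.card_le_card hsub).trans ((Finset.card_biUnion_le_card_mul _ _ D ?_).trans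
    (Nat.mul_le_mul_right D hN))
  intro m hm
  by_cases hmI : m ∈ I
  · have : I.filter (fun v => v = m ∨ G.Adj m v) ⊆ {m} := by
      intro v hv
      obtain ⟨hv, rfl | h⟩ := Finset.mem_filter.1 hv
      · simp
      · exact (hIi hmI hv h.ne h).elim
    exact (Finset.card_le_card this).trans (by rw [Finset.card_singleton]; exact hD)
  · refine (hlow m hm _ (hIi.mono (Finset.coe_subset.2 (Finset.filter_subset _ _))) ?_).le
    intro v hv
    obtain ⟨hvI, rfl | h⟩ := Finset.mem_filter.1 hv
    · exact (hmI hvI).elim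
    · exact ⟨h, (hI hvI).1⟩

/-- If each vertex of an independent set `Y ⊆ X` has fewer than `D` independent neighbours in `U`,
and each vertex of `U` has a neighbour in `Y`, then `α(G[U]) ≤ k(2D+1)`. -/
theorem InducedMatchingNumOnLE.indepNumOnLE_neighbors {k D : ℕ} {X Y U : Set V}
    (hX : G.InducedMatchingNumOnLE X k) (hYX : Y ⊆ X) (hY : G.IsIndepSet Y)
    (hlow : ∀ y ∈ Y, ∀ I : Finset V, G.IsIndepSet I → (∀ w ∈ I, G.Adj y w) → I.card < D)
    (hU : ∀ u ∈ U, ∃ y ∈ Y, G.Adj u y) : G.IndepNumOnLE U (k * (2 * D + 1)) := by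
  classical
  intro I hIU hI
  by_contra! hcard
  have hU' : ∀ u, ∃ y, u ∈ U → y ∈ Y ∧ G.Adj u y := by
    intro u
    by_cases hu : u ∈ U
    · obtain ⟨y, hy⟩ := hU u hu
      exact ⟨y, fun _ => hy⟩
    · exact ⟨u, fun h => (hu h).elim⟩
  choose y hy using hU'
  obtain ⟨K, hKI, hK, hKR⟩ := exists_card_eq_of_outDegree_le (fun u u' => G.Adj (y u) u') k I
    (d := D) (fun u hu => by
      refine (hlow (y u) (hy u (hIU hu)).1 _
        (hI.mono (Finset.coe_subset.2 (Finset.filter_subset _ _))) ?_).le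
      intro w hw
      exact (Finset.mem_filter.1 hw).2.2) hcard
  have hyK : ∀ u ∈ K, y u ∈ Y ∧ G.Adj u (y u) := fun u hu => hy u (hIU (hKI hu))
  have := hX.card_le (hI.mono (Finset.coe_subset.2 hKI)) (fun u hu => (hyK u hu).2)
    (fun u hu => Or.inr (hYX (hyK u hu).1))
    (fun u hu u' hu' hne h => hKR u' hu' u hu hne.symm h.symm)
    (fun u hu u' hu' _ h => hY (hyK u hu).1 (hyK u' hu').1 h.ne h)
  omega

theorem IsInducedMatchingIn.insert [DecidableEq V] {M : Finset (Sym2 V)}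
    (hM : G.IsInducedMatchingIn M) {y u : V} (hyu : G.Adj y u)
    (hy : ∀ e ∈ M, ∀ m ∈ e, y ≠ m ∧ ¬ G.Adj m y) (hu : ∀ e ∈ M, ∀ m ∈ e, u ≠ m ∧ ¬ G.Adj m u) :
    G.IsInducedMatchingIn (insert s(y, u) M) := by
  have hnew : ∀ e ∈ M, ∀ m ∈ e, ∀ v ∈ s(y, u), v ≠ m ∧ ¬ G.Adj m v := by
    intro e he m hm v hv
    rcases Sym2.mem_iff.1 hv with rfl | rfl
    · exact hy e he m hm
    · exact hu e he m hm
  refine ⟨⟨?_, ?_⟩, ?_⟩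
  · intro e he
    rcases Finset.mem_insert.1 he with rfl | he
    · exact hyu
    · exact hM.1.1 e he
  · intro e he f hf hef v hve hvf
    rcases Finset.mem_insert.1 he with rfl | he <;> rcases Finset.mem_insert.1 hf with rfl | hf
    · exact hef rfl
    · exact (hnew f hf v hvf v hve).1 rfl
    · exact (hnew e he v hve v hvf).1 rfl
    · exact hM.1.2 e he f hf hef v hve hvf
  · intro e he f hf hef a ha b hb hab
    rcases Finset.mem_insert.1 he with rfl | he <;> rcases Finset.mem_insert.1 hf with rfl | hf
    · exact hef rfl
    · exact (hnew f hf b hb a ha).2 hab.symm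
    · exact (hnew e he a ha b hb).2 hab
    · exact hM.2 e he f hf hef a ha b hb hab

/-- A set `X` in which only small induced matchings are anchored can be replaced by a set `S` of
small independence number that separates as well as `X` does: the vertices of `X \ S` are isolated
in `G - S`. -/
theorem InducedMatchingNumOnLE.exists_separator [Finite V] {t k L d D : ℕ} {X : Set V}
    (hX : G.InducedMatchingNumOnLE X k)
    (hfree : ¬ (completeBipartiteGraph (Fin t) (Fin t)).IsIndContained G) (ht : 0 < t) (hL : 0 < L)
    (hd : t * D ≤ L * d) (hDL : t * L ^ (t + 1) ≤ D) (hD : k * (2 * d + L) < D) :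
    ∃ S : Set V, G.IndepNumOnLE S (k * (2 * L + 1) + k * 2 * D + k * (2 * D + 1)) ∧
      ∀ v ∈ X, v ∉ S → ∀ u, G.Adj v u → u ∈ S := by
  classical
  -- The vertices of high degree, with degrees counted by independent sets.
  set Q : Set V := {v | ∃ I : Finset V, G.IsIndepSet I ∧ I.card = D ∧
    ∀ w ∈ I, G.Adj v w ∧ (v ∈ X ∨ w ∈ X)} with hQ
  have hlow : ∀ v, v ∉ Q → ∀ I : Finset V, G.IsIndepSet I →
      (∀ w ∈ I, G.Adj v w ∧ (v ∈ X ∨ w ∈ X)) → I.card < D := by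
    intro v hv I hI hIv
    by_contra! hcard
    obtain ⟨I', hI', hc⟩ := Finset.exists_subset_card_eq hcard
    exact hv ⟨I', hI.mono (Finset.coe_subset.2 hI'), hc, fun w hw => hIv w (hI' hw)⟩
  -- A maximum induced matching that avoids `Q` and whose edges meet `X`.
  obtain ⟨M, ⟨hM, hMX, hMQ⟩, hmax⟩ : ∃ M : Finset (Sym2 V),
      (G.IsInducedMatchingIn M ∧ (∀ e ∈ M, ∃ v ∈ e, v ∈ X) ∧ ∀ e ∈ M, ∀ v ∈ e, v ∉ Q) ∧
      ∀ M' : Finset (Sym2 V), (G.IsInducedMatchingIn M' ∧ (∀ e ∈ M', ∃ v ∈ e, v ∈ X) ∧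
        ∀ e ∈ M', ∀ v ∈ e, v ∉ Q) → M'.card ≤ M.card := by
    have hne : {M : Finset (Sym2 V) | G.IsInducedMatchingIn M ∧ (∀ e ∈ M, ∃ v ∈ e, v ∈ X) ∧
        ∀ e ∈ M, ∀ v ∈ e, v ∉ Q}.Nonempty := ⟨∅, by simp [IsInducedMatchingIn, IsMatchingIn]⟩
    obtain ⟨M, hM, hmax⟩ := Set.exists_max_image _ Finset.card (Set.toFinite _) hne
    exact ⟨M, hM, hmax⟩
  have hMk : M.card ≤ k := hX M hM hMX
  set N : Finset V := M.biUnion Sym2.toFinset with hN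
  have hmemN : ∀ {m : V}, m ∈ N ↔ ∃ e ∈ M, m ∈ e := by
    intro m
    simp [hN]
  have hNk : N.card ≤ k * 2 := by
    refine (Finset.card_biUnion_le_card_mul _ _ 2 fun e _ => ?_).trans
      (Nat.mul_le_mul_right 2 hMk)
    rw [Sym2.card_toFinset]
    split_ifs <;> omega
  set R : Set V := {v | v ∈ X ∧ ∃ m ∈ N, v = m ∨ G.Adj m v} with hR
  set Y : Set V := X \ (Q ∪ R) with hY
  set U : Set V := {u | u ∉ Q ∧ ∃ y ∈ Y, G.Adj u y} with hU
  -- By maximality, edges at `Y` outside `Q` end next to the matching.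
  have hYN : ∀ y ∈ Y, ∀ u, u ∉ Q → G.Adj y u → ∃ m ∈ N, u = m ∨ G.Adj m u := by
    intro y hy u hu hyu
    by_contra! hcon
    have hyN : ∀ m ∈ N, y ≠ m ∧ ¬ G.Adj m y := fun m hm =>
      ⟨fun h => hy.2 (Or.inr ⟨hy.1, m, hm, Or.inl h⟩),
        fun h => hy.2 (Or.inr ⟨hy.1, m, hm, Or.inr h⟩)⟩
    have hnot : s(y, u) ∉ M := fun h =>
      (hyN y (hmemN.2 ⟨_, h, Sym2.mem_mk_left _ _⟩)).1 rfl
    have := hmax (insert s(y, u) M) ⟨hM.insert hyu (fun e he m hm => hyN m (hmemN.2 ⟨e, he, hm⟩))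
      (fun e he m hm => hcon m (hmemN.2 ⟨e, he, hm⟩)), ?_, ?_⟩
    · rw [Finset.card_insert_of_notMem hnot] at this
      omega
    · intro e he
      rcases Finset.mem_insert.1 he with rfl | he
      · exact ⟨y, Sym2.mem_mk_left _ _, hy.1⟩
      · exact hMX e he
    · intro e he v hv
      rcases Finset.mem_insert.1 he with rfl | he
      · rcases Sym2.mem_iff.1 hv with rfl | rfl
        · exact fun h => hy.2 (Or.inl h)
        · exact hu
      · exact hMQ e he v hv
  have hYi : G.IsIndepSet Y := by
    intro y hy y' hy' _ h
    exact hy'.2 (Or.inr ⟨hy'.1, hYN y hy y' (fun h => hy'.2 (Or.inl h)) h⟩)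
  refine ⟨Q ∪ R ∪ U, ((hX.indepNumOnLE_of_high hfree ht hL hd hDL hD fun v hv => hv).union ?_).union
    ?_, ?_⟩
  · refine indepNumOnLE_closedNeighbors (by omega) hNk fun m hm I hI hIm => ?_
    obtain ⟨e, he, hme⟩ := hmemN.1 hm
    exact hlow m (hMQ e he m hme) I hI fun w hw => ⟨(hIm w hw).1, Or.inr (hIm w hw).2⟩
  · refine hX.indepNumOnLE_neighbors Set.sdiff_subset hYi (fun y hy I hI hIy => ?_)
      fun u hu => hu.2
    exact hlow y (fun h => hy.2 (Or.inl h)) I hI fun w hw => ⟨hIy w hw, Or.inl hy.1⟩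
  · intro v hv hvS u hvu
    by_cases hu : u ∈ Q
    · exact Or.inl (Or.inl hu)
    · exact Or.inr ⟨hu, v, ⟨hv, fun h => hvS (Or.inl h)⟩, hvu.symm⟩

theorem indepNum_induce_le {S : Set V} {n : ℕ} (h : G.IndepNumOnLE S n) [Finite V] :
    (G.induce S).indepNum ≤ n := by
  classical
  obtain ⟨s, hs⟩ := (G.induce S).exists_isNIndepSet_indepNum
  rw [← hs.card_eq, ← Finset.card_map (Function.Embedding.subtype _)]
  refine h _ ?_ ?_
  · intro v hv
    obtain ⟨w, -, rfl⟩ := Finset.mem_map.1 (Finset.mem_coe.1 hv)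
    exact w.2
  · intro a ha b hb hne
    obtain ⟨a, has, rfl⟩ := Finset.mem_map.1 (Finset.mem_coe.1 ha)
    obtain ⟨b, hbs, rfl⟩ := Finset.mem_map.1 (Finset.mem_coe.1 hb)
    exact hs.isIndepSet has hbs fun h => hne (by rw [h])

theorem exists_inducedMatchingNumOnLE_bag [Finite V] {k : ℕ}
    (h : G.inducedMatchingTreewidth ≤ k) :
    ∃ T : G.TreeDecomposition, ∀ x, G.InducedMatchingNumOnLE (T.bag x) k := by
  obtain ⟨T, hT⟩ := Nat.sInf_mem
    (Set.range_nonempty (TreeDecomposition.inducedMatchingNum (G := G)))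
  have := T.finite_node
  refine ⟨T, fun x => inducedMatchingNumOnLE_of_inducedMatchingNumOn_le ?_⟩
  have h1 : G.inducedMatchingNumOn (T.bag x) ≤ T.inducedMatchingNum :=
    le_ciSup (f := fun x => G.inducedMatchingNumOn (T.bag x)) (Set.finite_range _).bddAbove x
  exact (h1.trans hT.le).trans h

/-! ### The bound -/

/-- The bound of the theorem with the smaller exponent `t + 2`. -/
theorem treeIndepNum_le_mul_pow {t k : ℕ} (ht : 0 < t) (hk : 0 < k) {V : Type*}
    [Finite V] (G : SimpleGraph V)
    (hfree : ¬ (completeBipartiteGraph (Fin t) (Fin t)).IsIndContained G)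
    (hG : G.inducedMatchingTreewidth ≤ k) :
    G.treeIndepNum ≤ 5 * (8 * t + 2 + 4 * (t * (4 * t) ^ (t + 1))) * k ^ (t + 2) := by
  classical
  obtain ⟨T, hT⟩ := exists_inducedMatchingNumOnLE_bag hG
  -- `L / t = 4k`, so that `d = D / (4k)` and the `k(2d + L)` forbidden choices number less than `D`.
  set L := 4 * t * k with hL
  set d := t * t * L ^ t with hd
  set D := t * L ^ (t + 1) with hD
  have hL0 : 0 < L := by positivity
  have hDd : D = 4 * k * d := by rw [hD, hd, pow_succ]; rw [hL]; ring
  have hLd : L ≤ d := by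
    calc L = 1 * L ^ 1 := by ring
      _ ≤ t * t * L ^ t := Nat.mul_le_mul (Nat.mul_pos ht ht) (Nat.pow_le_pow_right hL0 ht)
  choose S hS hSX using fun x => (hT x).exists_separator hfree ht hL0 (d := d) (D := D)
    (by rw [hDd, hL]; exact le_of_eq (by ring)) le_rfl (by
      rw [hDd]
      calc k * (2 * d + L) ≤ k * (2 * d + d) := by gcongr
        _ < 4 * k * d := by nlinarith [Nat.mul_pos hk (hL0.trans_le hLd)])
  set σ := k * (2 * L + 1) + k * 2 * D + k * (2 * D + 1) with hσ
  have hσle : σ ≤ (8 * t + 2 + 4 * (t * (4 * t) ^ (t + 1))) * k ^ (t + 2) := by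
    have h1 : σ = 8 * t * k ^ 2 + 2 * k + 4 * (t * (4 * t) ^ (t + 1)) * k ^ (t + 2) := by
      rw [hσ, hD, hL, mul_pow]; ring
    have h2 : k ^ 2 ≤ k ^ (t + 2) := Nat.pow_le_pow_right hk (by omega)
    have h3 : k ≤ k ^ (t + 2) := Nat.le_self_pow (by omega) k
    rw [h1, add_mul, add_mul]
    gcongr
  obtain ⟨T', hT'⟩ := exists_treeDecomposition_of_balanced (G := G) (σ := σ) (by positivity)
    fun J hJ _ => by
      obtain ⟨x, hx⟩ := T.exists_balanced S hSX J hJ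
      exact ⟨S x, hS x, hx⟩
  calc G.treeIndepNum ≤ T'.indepNum := Nat.sInf_le ⟨T', rfl⟩
    _ ≤ 5 * σ := ciSup_le' fun x => indepNum_induce_le (hT' x)
    _ ≤ _ := by rw [mul_assoc]; gcongr

end SimpleGraph

theorem theorem1p2 (t : ℕ) (ht : 0 < t) :
    ∃ C : ℕ, ∀ μ : ℕ, 0 < μ →
      ∀ (V : Type*) [Finite V] (G : SimpleGraph V),
        ¬ (completeBipartiteGraph (Fin t) (Fin t)).IsIndContained G →
        G.inducedMatchingTreewidth ≤ μ →
        G.treeIndepNum ≤ C * μ ^ (3 * t ^ 2 + 1) := by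
  refine ⟨5 * (8 * t + 2 + 4 * (t * (4 * t) ^ (t + 1))), fun μ hμ V _ G hfree hG => ?_⟩
  refine (G.treeIndepNum_le_mul_pow ht hμ hfree hG).trans ?_
  exact Nat.mul_le_mul_left _ (Nat.pow_le_pow_right hμ (by nlinarith))
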